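/- Let $K$ be a compact Hausdorff space and let $\mathcal{C}(K)$ be the Banach lattice of continuous real-valued functions on $K$ with the supremum norm and the pointwise order. The following conditions are equivalent: (i) $K$ has finitely many non-isolated points; (ii) $\mathcal{C}(K)_a$ has finite codimension in $\mathcal{C}(K)$; (iii) the pointwise topology on $\mathcal{C}(K)$ has the Kadec–Pełczyński property; (iii') the pointwise topology on $\mathcal{C}(K)$ has the sequential Kadec–Pełczyński property; (iv) the weak topology on $\mathcal{C}(K)$ has the sequential Kadec–Pełczyński property; (iv') the absolute weak topology on $\mathcal{C}(K)$ has the sequential Kadec–Pełczyński property; (v) every dispersed closed subspace of $\mathcal{C}(K)$ is finite-dimensional; (v') every $2$-dispersed closed subspace of $\mathcal{C}(K)$ is finite-dimensional; (v'') every closed subspace of $\mathcal{C}(K)$ with the SPR (stable phase retrieval) property is finite-dimensional. Here, for $F=\mathcal{C}(K)$: elements $f,g\in F$ are disjoint if $|f|\wedge|g|=0$, and a disjoint sequence or pair is one whose members are pairwise disjoint. $F_a$ is the largest ideal (solid linear subspace) of $F$ on which the norm is order continuous, i.e. such that $\|f_\alpha\|\to0$ for every net $f_\alpha\downarrow 0$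 in the ideal. The absolute weak topology is the linear topology determined by the neighbourhoods of zero $\{f\in F:\nu(|f|)<\varepsilon\}$, where $\nu$ is a positive continuous functional on $F$ and $\varepsilon>0$. A sequence $(e_n)$ of norm-one elements of $F$ is almost disjoint if there is a disjoint sequence $(f_n)$ in $F$ with $\|f_n-e_n\|\to0$. A topology $\tau$ on $F$ has the Kadec–Pełczyński property if for every $\tau$-null net $(f_p)_{p\in P}$ of norm-one elements of $F$ and every sequence $(q_n)_{n\in\mathbb N}$ in $P$ there is a sequence $(p_n)_{n\in\mathbb N}$ in $P$ such that $p_n\ge q_n$ for all $n$ and $(f_{p_n})_{n\in\mathbb N}$ is almost disjoint; the sequential Kadec–Pełczyński property is the same condition for sequences only, i.e. for $P=\mathbb N$. A subspace $E\subset F$ is dispersed if it contains no almost disjoint sequence; it is $2$-dispersed if there is $r>0$ such that there are no two disjoint norm-one elements of $F$ both at distance less than $r$ from $E$; it has the SPR property if there is $r\ge1$ such that $\min(\|g+h\|,\|g-h\|)\le r\,\big\||g|-|h|\big\|$ for all $g,h\in E$. -/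

import Mathlib

open Filter Topology

universe u v

/-! Definitions for a real normed lattice `F` (in the theorem, `F = C(K, ℝ)`). -/

namespace DispersedCK

section Dispersed

variable {F : Type*} [NormedAddCommGroup F] [Lattice F]

/-- `f ⟂ g`, i.e. `|f| ∧ |g| = 0`. -/
def LatDisjoint (f g : F) : Prop := |f| ⊓ |g| = 0

/-- An almost disjoint sequence: normalized, and asymptotic to a pairwise disjoint sequence. -/
def AlmostDisjoint (e : ℕ → F) : Prop :=
  (∀ n, ‖e n‖ = 1) ∧
    ∃ f : ℕ → F, (∀ m n, m ≠ n → LatDisjoint (f m) (f n)) ∧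
      Tendsto (fun n => ‖f n - e n‖) atTop (𝓝 0)

variable [NormedSpace ℝ F]

/-- A subspace is dispersed if it contains no almost disjoint sequence. -/
def IsDispersed (E : Submodule ℝ F) : Prop :=
  ¬ ∃ e : ℕ → F, (∀ n, e n ∈ E) ∧ AlmostDisjoint e

/-- `n`-dispersed subspaces (`n ≥ 2`): for some `r > 0` there is no disjoint normalized `n`-tuple
in `F` all of whose members are at distance less than `r` from `E`. -/
def IsNDispersed (n : ℕ) (E : Submodule ℝ F) : Prop :=
  ∃ r : ℝ, 0 < r ∧ ¬ ∃ f : Fin n → F, (∀ k, ‖f k‖ = 1) ∧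
    (∀ j k, j ≠ k → LatDisjoint (f j) (f k)) ∧ ∀ k, Metric.infDist (f k) (E : Set F) < r

/-- Stable phase retrieval. -/
def HasSPR (E : Submodule ℝ F) : Prop :=
  ∃ r : ℝ, 1 ≤ r ∧ ∀ g ∈ E, ∀ h ∈ E, min ‖g + h‖ ‖g - h‖ ≤ r * ‖|g| - |h|‖

end Dispersed

section OrderContinuous

variable {F : Type*} [NormedAddCommGroup F] [Lattice F] [NormedSpace ℝ F]

/-- A (not necessarily closed) lattice ideal: a solid linear subspace. -/
def IsLatticeIdeal (I : Submodule ℝ F) : Prop :=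
  LatticeOrderedAddCommGroup.IsSolid (I : Set F)

/-- The norm is order continuous on `I`: if a nonempty family of elements of `I` is directed
downwards with infimum `0` in `I`, then its norms decrease to `0`. -/
def HasOrderContinuousNorm (I : Submodule ℝ F) : Prop :=
  ∀ D : Set I, D.Nonempty → DirectedOn (· ≥ ·) D → IsGLB D 0 →
    ∀ ε : ℝ, 0 < ε → ∃ d ∈ D, ‖d‖ < ε

variable (F) in
/-- The order continuous part `F_a`: the largest ideal on which the norm is order continuous. -/
noncomputable def orderContinuousPart : Submodule ℝ F :=
  sSup {I : Submodule ℝ F | IsLatticeIdeal I ∧ HasOrderContinuousNorm I}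

end OrderContinuous

section Topologies

/-- The topology of pointwise convergence on `C(K)`. -/
abbrev pointwiseTopology (K : Type*) [TopologicalSpace K] : TopologicalSpace C(K, ℝ) :=
  TopologicalSpace.induced (fun (f : C(K, ℝ)) (x : K) => f x) inferInstance

/-- The weak topology `σ(F, F*)`. -/
noncomputable abbrev weakTopology (F : Type*) [NormedAddCommGroup F] [NormedSpace ℝ F] : TopologicalSpace F :=
  TopologicalSpace.induced (toWeakSpace ℝ F) inferInstance

variable (F : Type*) [NormedAddCommGroup F] [Lattice F] [NormedSpace ℝ F]

/-- The positive continuous functionals `F*₊`. -/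
def PositiveDual : Type _ := {ν : StrongDual ℝ F // ∀ f : F, 0 ≤ f → 0 ≤ ν f}

variable [IsOrderedAddMonoid F]

variable {F} in
theorem PositiveDual.mono (ν : PositiveDual F) {f g : F} (h : f ≤ g) : ν.1 f ≤ ν.1 g := by
  have := ν.2 (g - f) (sub_nonneg.mpr h)
  rw [map_sub] at this
  linarith

variable [IsOrderedModule ℝ F]

/-- The seminorms `f ↦ ν |f|`, for `ν ∈ F*₊`. -/
noncomputable def absWeakSeminorms : SeminormFamily ℝ F (PositiveDual F) := fun ν =>
  Seminorm.ofSMulLE (fun f => ν.1 |f|) (by simp)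
    (fun f g => by
      rw [← map_add]
      exact ν.mono (abs_add_le f g))
    (fun r f => by
      rw [Real.norm_eq_abs, ← smul_eq_mul, ← map_smul]
      refine ν.mono ?_
      have h1 : ∀ (s : ℝ), s • f ≤ |s| • |f| := fun s => by
        rcases le_total 0 s with hs | hs
        · rw [abs_of_nonneg hs]
          exact smul_le_smul_of_nonneg_left (le_abs_self f) hs
        · rw [abs_of_nonpos hs, ← neg_smul_neg]
          exact smul_le_smul_of_nonneg_left (neg_le_abs f) (neg_nonneg.mpr hs)
      refine abs_le'.mpr ⟨h1 r, ?_⟩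
      have h2 := h1 (-r)
      rwa [abs_neg, neg_smul] at h2)

/-- The absolute weak topology: the linear topology generated by the neighbourhoods
`{f | ν |f| < ε}` of zero, for `ν ∈ F*₊` and `ε > 0`. -/
noncomputable abbrev absWeakTopology : TopologicalSpace F :=
  letI : Nonempty (PositiveDual F) := ⟨⟨0, fun _ _ => le_rfl⟩⟩
  (absWeakSeminorms F).moduleFilterBasis.topology

end Topologies

section KadecPelczynski

variable {F : Type u} [NormedAddCommGroup F] [Lattice F]

/-- The condition of the Kadec–Pełczyński property of the topology `τ`, for nets indexed by `P`:
if `f : P → F` is a normalized `τ`-null net, then for every sequence `q` in `P` there is a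
sequence `p ≥ q` such that `f ∘ p` is almost disjoint. -/
def KadecPelczynskiFor (τ : TopologicalSpace F) (P : Type v) [Preorder P] : Prop :=
  ∀ f : P → F, (∀ i, ‖f i‖ = 1) → Tendsto f atTop (@nhds F τ 0) →
    ∀ q : ℕ → P, ∃ p : ℕ → P, (∀ n, q n ≤ p n) ∧ AlmostDisjoint (fun n => f (p n))

/-- The Kadec–Pełczyński property, for nets over directed sets in the universe `v`. -/
def HasKadecPelczynski (τ : TopologicalSpace F) : Prop :=
  ∀ (P : Type v) [Preorder P] [IsDirectedOrder P] [Nonempty P], KadecPelczynskiFor τ P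

/-- The sequential Kadec–Pełczyński property. -/
def HasSeqKadecPelczynski (τ : TopologicalSpace F) : Prop := KadecPelczynskiFor τ ℕ

end KadecPelczynski

end DispersedCK

/-! If only finitely many points are non-isolated, a gliding hump works. A function smaller than `ε`
at those points is smaller than `ε` off a finite set of isolated points, by compactness, and cutting
a function off outside such a set keeps it continuous. Hence a normalized family with members
arbitrarily small on every finite set contains an almost disjoint sequence
(`exists_almostDisjoint`). This gives the Kadec–Pełczyński properties. It also shows that a
dispersed subspace is finite-dimensional, since an infinite-dimensional one has normalized elements
vanishing on any given finite set. In `C(K)`, SPR implies 2-dispersed, which implies dispersed.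

If infinitely many points are non-isolated, a single sequence defeats all these properties
(`exists_isEntangled`). Its absolute sums are uniformly bounded, so it is null in the weak and
absolute weak topologies. Any two members overlap substantially, so no sequence of its members is
almost disjoint. Since any two overlap with equal and with opposite signs, its closed span has SPR
(`IsEntangled.hasSPR_closure`), and this span is infinite-dimensional.

The order continuous part consists of the functions vanishing at all non-isolated points
(`orderContinuousPart_eq`), so its codimension is finite exactly when there are finitely many such
points. -/

namespace DispersedCK

/-! ### Disjoint neighbourhoods, bumps and the entangled sequence. -/

section Construction

variable {X : Type*} [TopologicalSpace X]

/-- In a regular Hausdorff space, an infinite set contains a sequence of points with pairwise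
disjoint open neighbourhoods. -/
theorem exists_seq_mem_isOpen_pairwise_disjoint [T3Space X] {S : Set X} (hS : S.Infinite) :
    ∃ (x : ℕ → X) (U : ℕ → Set X), (∀ n, x n ∈ S) ∧ (∀ n, x n ∈ U n) ∧ (∀ n, IsOpen (U n)) ∧
      ∀ m n, m ≠ n → Disjoint (U m) (U n) := by
  have : Infinite S := hS.to_subtype
  obtain ⟨O, hOi, hOo, hOd⟩ := exists_seq_infinite_isOpen_pairwise_disjoint S
  choose x hx using fun n => (hOi n).nonempty
  choose G hGo hG using fun n => isOpen_induced_iff.mp (hOo n)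
  have hxG : ∀ m n, (x m : X) ∈ G n → m = n := by
    intro m n h
    by_contra hne
    have : x m ∈ O n := by rw [← hG n]; exact h
    exact Set.disjoint_left.mp (hOd hne) (hx m) this
  have hxx : ∀ n, (x n : X) ∈ G n := by
    intro n
    have := hx n
    rw [← hG n] at this
    exact this
  choose C hC hCc hCG using fun n => exists_mem_nhds_isClosed_subset ((hGo n).mem_nhds (hxx n))
  -- The ambient extensions `G n` of the relatively open sets may overlap, so the earlier closed
  -- neighbourhoods are removed; `x n` survives because it lies in no other `G m`.
  refine ⟨fun n => x n, fun n => interior (C n) \ ⋃ m ∈ Finset.range n, C m,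
    fun n => (x n).2, fun n => ⟨mem_interior_iff_mem_nhds.mpr (hC n), ?_⟩, fun n => ?_, ?_⟩
  · simp only [Set.mem_iUnion, not_exists]
    intro m hm hmem
    have := hxG n m (hCG m hmem)
    rw [Finset.mem_range] at hm
    omega
  · exact isOpen_interior.sdiff ((Finset.range n).finite_toSet.isClosed_biUnion fun m _ => hCc m)
  · have key : ∀ m n, m < n → Disjoint (interior (C m) \ ⋃ k ∈ Finset.range m, C k)
        (interior (C n) \ ⋃ k ∈ Finset.range n, C k) := by
      intro m n hmn
      refine Set.disjoint_left.mpr fun y hy hy' => hy'.2 ?_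
      exact Set.mem_biUnion (Finset.mem_coe.mpr (Finset.mem_range.mpr hmn)) (interior_subset hy.1)
    intro m n hmn
    rcases lt_or_gt_of_ne hmn with h | h
    · exact key m n h
    · exact (key n m h).symm

/-- An infinite open subset of a Hausdorff space contains a sequence of pairwise disjoint nonempty
open sets. -/
theorem exists_seq_isOpen_subset_pairwise_disjoint [T2Space X] {V : Set X} (hV : IsOpen V)
    (hVi : V.Infinite) :
    ∃ (t : ℕ → X) (W : ℕ → Set X), (∀ n, t n ∈ W n) ∧ (∀ n, IsOpen (W n)) ∧ (∀ n, W n ⊆ V) ∧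
      ∀ m n, m ≠ n → Disjoint (W m) (W n) := by
  have : Infinite V := hVi.to_subtype
  obtain ⟨O, hOi, hOo, hOd⟩ := exists_seq_infinite_isOpen_pairwise_disjoint V
  choose t ht using fun n => (hOi n).nonempty
  refine ⟨fun n => t n, fun n => Subtype.val '' O n, fun n => ⟨t n, ht n, rfl⟩,
    fun n => hV.isOpenMap_subtype_val _ (hOo n), fun n => ?_, fun m n hmn => ?_⟩
  · rintro _ ⟨y, _, rfl⟩
    exact y.2
  · exact (Set.disjoint_image_iff Subtype.val_injective).mpr (hOd hmn)

/-- Urysohn functions that are `1` on a neighbourhood of a given point. -/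
theorem exists_bump [NormalSpace X] [T1Space X] {U : Set X} (hU : IsOpen U) {x : X} (hx : x ∈ U) :
    ∃ (f : C(X, ℝ)) (V : Set X), IsOpen V ∧ x ∈ V ∧ (∀ y ∈ V, f y = 1) ∧ (∀ y ∉ U, f y = 0) ∧
      ∀ y, 0 ≤ f y ∧ f y ≤ 1 := by
  obtain ⟨C, hC, hCc, hCU⟩ := exists_mem_nhds_isClosed_subset (hU.mem_nhds hx)
  obtain ⟨f, hf0, hf1, hf⟩ := exists_continuous_zero_one_of_isClosed hU.isClosed_compl hCc
    (Set.disjoint_left.mpr fun y hy hy' => hy (hCU hy'))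
  exact ⟨f, interior C, isOpen_interior, mem_interior_iff_mem_nhds.mpr hC,
    fun y hy => hf1 (interior_subset hy), fun y hy => hf0 hy, fun y => hf y⟩

/-- A sequence of functions with uniformly bounded absolute sums, any two of which are
simultaneously large at two points, with the same and with opposite signs respectively. -/
structure IsEntangled (e : ℕ → C(X, ℝ)) : Prop where
  bound : ∀ y, ∃ n k, ∀ m, |e m y| ≤ if m = n then 1 else if m = k then 1 / 2 else 0
  peak : ∀ n, ∃ y, ∀ m, e m y = if m = n then 1 else 0
  pos : ∀ n k, n < k → ∃ y, ∀ m, e m y = if m = n then 1 else if m = k then 1 / 2 else 0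
  neg : ∀ n k, n < k → ∃ y, ∀ m, e m y = if m = n then 1 else if m = k then -(1 / 2) else 0

/-- Each `ψ n` is `1` on a neighbourhood of a non-isolated point. That neighbourhood is infinite,
which leaves room for infinitely many disjoint bumps `φ n j` on the plateau. -/
theorem exists_nested_bumps [NormalSpace X] [T2Space X]
    (hX : {x : X | ¬ IsOpen ({x} : Set X)}.Infinite) :
    ∃ (ψ : ℕ → C(X, ℝ)) (φ : ℕ → ℕ → C(X, ℝ)) (t : ℕ → ℕ → X),
      (∀ n y, 0 ≤ ψ n y ∧ ψ n y ≤ 1) ∧ (∀ n j y, 0 ≤ φ n j y ∧ φ n j y ≤ 1) ∧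
      (∀ n m y, n ≠ m → ψ n y ≠ 0 → ψ m y = 0) ∧ (∀ n j y, φ n j y ≠ 0 → ψ n y = 1) ∧
      (∀ n i j y, i ≠ j → φ n i y ≠ 0 → φ n j y = 0) ∧ ∀ n j, φ n j (t n j) = 1 := by
  obtain ⟨x, U, hxS, hxU, hUo, hUd⟩ := exists_seq_mem_isOpen_pairwise_disjoint hX
  choose ψ V hVo hxV hψ1 hψ0 hψ using fun n => exists_bump (hUo n) (hxU n)
  have hVi : ∀ n, (V n).Infinite := by
    intro n
    have : NeBot (𝓝[≠] (x n)) := by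
      refine ⟨fun h => hxS n ?_⟩
      rwa [isOpen_singleton_iff_punctured_nhds]
    exact infinite_of_mem_nhds (x n) ((hVo n).mem_nhds (hxV n))
  choose t W htW hWo hWV hWd using fun n =>
    exists_seq_isOpen_subset_pairwise_disjoint (hVo n) (hVi n)
  choose φ Z hZo htZ hφ1 hφ0 hφ using fun n j => exists_bump (hWo n j) (htW n j)
  have hψU : ∀ n y, ψ n y ≠ 0 → y ∈ U n := fun n y h => by_contra fun h' => h (hψ0 n y h')
  have hφW : ∀ n j y, φ n j y ≠ 0 → y ∈ W n j := fun n j y h =>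
    by_contra fun h' => h (hφ0 n j y h')
  refine ⟨ψ, φ, t, hψ, hφ, ?_, ?_, ?_, fun n j => hφ1 n j _ (htZ n j)⟩
  · intro n m y hnm h
    exact hψ0 m y (Set.disjoint_left.mp (hUd n m hnm) (hψU n y h))
  · intro n j y h
    exact hψ1 n y (hWV n j (hφW n j y h))
  · intro n i j y hij h
    exact hφ0 n j y (Set.disjoint_left.mp (hWd n i j hij) (hφW n i y h))

theorem exists_isEntangled [NormalSpace X] [T2Space X]
    (hX : {x : X | ¬ IsOpen ({x} : Set X)}.Infinite) : ∃ e : ℕ → C(X, ℝ), IsEntangled e := by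
  obtain ⟨ψ, φ, t, hψ, hφ, hψd, hφψ, hφd, hφt⟩ := exists_nested_bumps hX
  -- On the plateau of each earlier `ψ n`, the function `e m` receives two private bumps, indexed `2
  -- * m` and `2 * m + 1`: one for each sign.
  let e : ℕ → C(X, ℝ) := fun m =>
    ψ m + (1 / 2 : ℝ) • ∑ n ∈ Finset.range m, (φ n (2 * m) - φ n (2 * m + 1))
  have he : ∀ m y, e m y =
      ψ m y + 1 / 2 * ∑ n ∈ Finset.range m, (φ n (2 * m) y - φ n (2 * m + 1) y) := by
    intro m y
    simp [e]
  have hφ0 : ∀ n j y, ψ n y = 0 → φ n j y = 0 := by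
    intro n j y h
    by_contra h'
    have := hφψ n j y h'
    rw [h] at this
    exact zero_ne_one this
  have hloc : ∀ n y, ψ n y ≠ 0 → ∀ m, e m y = if m = n then ψ n y else
      if n < m then 1 / 2 * (φ n (2 * m) y - φ n (2 * m + 1) y) else 0 := by
    intro n y hn m
    have hsum : ∑ k ∈ Finset.range m, (φ k (2 * m) y - φ k (2 * m + 1) y) =
        if n < m then φ n (2 * m) y - φ n (2 * m + 1) y else 0 := by
      have h0 : ∀ k, k ≠ n → φ k (2 * m) y - φ k (2 * m + 1) y = 0 := by
        intro k hk
        have := hψd n k y hk.symm hn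
        rw [hφ0 k _ y this, hφ0 k _ y this, sub_zero]
      split_ifs with hnm
      · exact Finset.sum_eq_single_of_mem n (Finset.mem_range.mpr hnm) fun k _ hk => h0 k hk
      · refine Finset.sum_eq_zero fun k hk => h0 k ?_
        rintro rfl
        exact hnm (Finset.mem_range.mp hk)
    rw [he, hsum]
    by_cases hmn : m = n
    · subst hmn
      simp
    · rw [hψd n m y (Ne.symm hmn) hn]
      simp [hmn]
  have hval : ∀ n j m, e m (t n j) = if m = n then 1 else
      if n < m then 1 / 2 * ((if 2 * m = j then 1 else 0) - if 2 * m + 1 = j then 1 else 0)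
        else 0 := by
    intro n j m
    have h1 : ψ n (t n j) = 1 := hφψ n j _ (by rw [hφt]; exact one_ne_zero)
    have h2 : ∀ i, φ n i (t n j) = if i = j then 1 else 0 := by
      intro i
      split_ifs with h
      · rw [h, hφt]
      · exact hφd n j i _ (Ne.symm h) (by rw [hφt]; exact one_ne_zero)
    rw [hloc n _ (by rw [h1]; exact one_ne_zero), h1, h2, h2]
  refine ⟨e, ?_, ?_, ?_, ?_⟩
  · intro y
    by_cases hy : ∃ n, ψ n y ≠ 0
    · obtain ⟨n, hn⟩ := hy
      obtain ⟨j, hj⟩ : ∃ j, ∀ i, i ≠ j → φ n i y = 0 := by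
        by_cases h : ∃ j, φ n j y ≠ 0
        · obtain ⟨j, hj⟩ := h
          exact ⟨j, fun i hi => hφd n j i y hi.symm hj⟩
        · push Not at h
          exact ⟨0, fun i _ => h i⟩
      -- The only bump `φ n j` that can be nonzero at `y` belongs to `e (j / 2)`.
      refine ⟨n, j / 2, fun m => ?_⟩
      rw [hloc n y hn m]
      by_cases hmn : m = n
      · simp only [hmn, if_true]
        rw [abs_of_nonneg (hψ n y).1]
        exact (hψ n y).2
      · simp only [hmn, if_false]
        by_cases hmj : m = j / 2
        · simp only [hmj, if_true]
          split_ifs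
          · have h1 := hφ n (2 * (j / 2)) y
            have h2 := hφ n (2 * (j / 2) + 1) y
            rw [abs_le]
            constructor <;> linarith
          · simp
        · rw [hj (2 * m) (by omega), hj (2 * m + 1) (by omega)]
          simp [hmj]
    · push Not at hy
      refine ⟨0, 0, fun m => ?_⟩
      have : e m y = 0 := by
        rw [he, hy m, Finset.sum_eq_zero]
        · simp
        · intro k _
          rw [hφ0 k _ y (hy k), hφ0 k _ y (hy k), sub_zero]
      rw [this, abs_zero]
      split_ifs <;> norm_num
  · intro n
    -- Bump `0` could only belong to `m = 0`, which never exceeds `n`; so only `e n` is nonzero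
    -- here.
    refine ⟨t n 0, fun m => ?_⟩
    rw [hval]
    split_ifs <;> first | rfl | contradiction | omega | simp
  · intro n k hnk
    refine ⟨t n (2 * k), fun m => ?_⟩
    rw [hval]
    split_ifs <;> first | rfl | contradiction | omega | simp
  · intro n k hnk
    refine ⟨t n (2 * k + 1), fun m => ?_⟩
    rw [hval]
    split_ifs <;> first | rfl | contradiction | omega | simp

end Construction

end DispersedCK

namespace DispersedCK

/-! ### Entangled sequences: weak nullity and failure of almost disjointness. -/

section Entangled

variable {K : Type*} [TopologicalSpace K] [CompactSpace K] {e : ℕ → C(K, ℝ)}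

omit [CompactSpace K] in
theorem IsEntangled.sum_abs_le (he : IsEntangled e) (S : Finset ℕ) (y : K) :
    ∑ m ∈ S, |e m y| ≤ 3 / 2 := by
  obtain ⟨n, k, h⟩ := he.bound y
  have h' : ∀ m, |e m y| ≤ (if m = n then 1 else 0) + if m = k then 1 / 2 else 0 := by
    intro m
    refine (h m).trans ?_
    split_ifs <;> norm_num
  calc ∑ m ∈ S, |e m y|
      ≤ ∑ m ∈ S, ((if m = n then 1 else 0) + if m = k then 1 / 2 else 0) :=
        Finset.sum_le_sum fun m _ => h' m
    _ = (if n ∈ S then 1 else 0) + if k ∈ S then 1 / 2 else 0 := by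
        rw [Finset.sum_add_distrib, Finset.sum_ite_eq', Finset.sum_ite_eq']
    _ ≤ 3 / 2 := by split_ifs <;> norm_num

theorem IsEntangled.norm_eq_one (he : IsEntangled e) (n : ℕ) : ‖e n‖ = 1 := by
  refine le_antisymm ((ContinuousMap.norm_le _ zero_le_one).mpr fun y => ?_) ?_
  · obtain ⟨m, k, h⟩ := he.bound y
    refine (h n).trans ?_
    split_ifs <;> norm_num
  · obtain ⟨y, hy⟩ := he.peak n
    have := (e n).norm_coe_le_norm y
    rw [hy n] at this
    simpa using this

/-- A functional tends to zero along a sequence with uniformly bounded absolute sums. -/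
theorem tendsto_functional_of_sum_abs_le {g : ℕ → C(K, ℝ)} {C : ℝ}
    (hg : ∀ (S : Finset ℕ) (y : K), ∑ m ∈ S, |g m y| ≤ C) (μ : StrongDual ℝ C(K, ℝ)) :
    Tendsto (fun n => μ (g n)) atTop (𝓝 0) := by
  -- The maximum with `0` covers empty `K`, where `C` may be negative. Choosing signs turns the sum
  -- of absolute values into a single value of `μ`.
  have hbound : ∀ S : Finset ℕ, ∑ m ∈ S, |μ (g m)| ≤ ‖μ‖ * max C 0 := by
    intro S
    have h1 : ∑ m ∈ S, |μ (g m)| = μ (∑ m ∈ S, (SignType.sign (μ (g m)) : ℝ) • g m) := by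
      rw [map_sum]
      refine Finset.sum_congr rfl fun m _ => ?_
      rw [map_smul, smul_eq_mul, sign_mul_self]
    rw [h1]
    refine (le_abs_self _).trans ((μ.le_opNorm _).trans ?_)
    refine mul_le_mul_of_nonneg_left ?_ (norm_nonneg _)
    refine (ContinuousMap.norm_le _ (le_max_right _ _)).mpr fun y => ?_
    rw [ContinuousMap.sum_apply]
    refine (norm_sum_le _ _).trans (le_trans ?_ ((hg S y).trans (le_max_left _ _)))
    refine Finset.sum_le_sum fun m _ => ?_
    rw [ContinuousMap.smul_apply, smul_eq_mul, norm_mul]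
    refine mul_le_of_le_one_left (norm_nonneg _) ?_
    rcases SignType.sign (μ (g m)) with _ | _ | _ <;> simp
  have hs : Summable fun m => |μ (g m)| :=
    summable_of_sum_le (fun _ => abs_nonneg _) hbound
  exact tendsto_zero_iff_abs_tendsto_zero _ |>.mpr hs.tendsto_atTop_zero

theorem latDisjoint_iff {f g : C(K, ℝ)} : LatDisjoint f g ↔ ∀ y, f y = 0 ∨ g y = 0 := by
  unfold LatDisjoint
  rw [ContinuousMap.ext_iff]
  refine forall_congr' fun y => ?_
  rw [ContinuousMap.inf_apply, ContinuousMap.abs_apply, ContinuousMap.abs_apply,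
    ContinuousMap.zero_apply]
  constructor
  · intro h
    rcases min_choice |f y| |g y| with h' | h'
    · left
      rw [← abs_eq_zero, ← h', h]
    · right
      rw [← abs_eq_zero, ← h', h]
  · rintro (h | h) <;> simp [h]

omit [CompactSpace K] in
/-- At some point, two members of an entangled sequence both have absolute value at least `1/2`. -/
theorem IsEntangled.exists_half_le (he : IsEntangled e) (n k : ℕ) :
    ∃ y, 1 / 2 ≤ |e n y| ∧ 1 / 2 ≤ |e k y| := by
  have key : ∀ n k, n < k → ∃ y, 1 / 2 ≤ |e n y| ∧ 1 / 2 ≤ |e k y| := by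
    intro n k h
    obtain ⟨y, hy⟩ := he.pos n k h
    refine ⟨y, ?_, ?_⟩
    · rw [hy n]; norm_num
    · rw [hy k]; simp [h.ne']
  rcases lt_trichotomy n k with h | rfl | h
  · exact key n k h
  -- Equal indices matter because the selection `p` below need not be injective.
  · obtain ⟨y, hy⟩ := he.peak n
    refine ⟨y, ?_, ?_⟩ <;> (rw [hy n]; norm_num)
  · obtain ⟨y, h1, h2⟩ := key k n h
    exact ⟨y, h2, h1⟩

/-- Approximants closer than `1/2` cannot vanish where the original functions have absolute value at
least `1/2`, so two late ones overlap. -/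
theorem IsEntangled.not_almostDisjoint (he : IsEntangled e) (p : ℕ → ℕ) :
    ¬ AlmostDisjoint fun n => e (p n) := by
  rintro ⟨_, f, hf, hlim⟩
  have hev := hlim.eventually (gt_mem_nhds (show (0 : ℝ) < 1 / 2 by norm_num))
  obtain ⟨N, hN⟩ := eventually_atTop.mp hev
  obtain ⟨y, h1, h2⟩ := he.exists_half_le (p N) (p (N + 1))
  have hne : ∀ i, N ≤ i → 1 / 2 ≤ |e (p i) y| → f i y ≠ 0 := by
    intro i hi hy h0
    have h3 := (f i - e (p i)).norm_coe_le_norm y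
    rw [ContinuousMap.sub_apply, h0, zero_sub, norm_neg, Real.norm_eq_abs] at h3
    linarith [hN i hi]
  rcases latDisjoint_iff.mp (hf N (N + 1) (by omega)) y with h | h
  · exact hne N le_rfl h1 h
  · exact hne (N + 1) (by omega) h2 h

theorem IsEntangled.not_hasSeqKadecPelczynski (he : IsEntangled e)
    {τ : TopologicalSpace C(K, ℝ)} (hτ : Tendsto e atTop (@nhds _ τ 0)) :
    ¬ HasSeqKadecPelczynski τ := by
  intro h
  obtain ⟨p, _, hp⟩ := h e he.norm_eq_one hτ id
  exact he.not_almostDisjoint p hp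

theorem tendsto_weakTopology_iff {ι : Type*} {l : Filter ι} {f : ι → C(K, ℝ)} :
    Tendsto f l (@nhds _ (weakTopology C(K, ℝ)) 0) ↔
      ∀ μ : StrongDual ℝ C(K, ℝ), Tendsto (fun i => μ (f i)) l (𝓝 0) := by
  rw [nhds_induced, tendsto_comap_iff]
  have hinj : Function.Injective (topDualPairing ℝ C(K, ℝ)).flip := fun f g hfg =>
    SeparatingDual.eq_iff_forall_dual_eq (R := ℝ) |>.mpr fun μ => LinearMap.congr_fun hfg μ
  refine (WeakBilin.tendsto_iff_forall_eval_tendsto _ hinj).trans (forall_congr' fun μ => ?_)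
  have h0 : (topDualPairing ℝ C(K, ℝ)).flip (toWeakSpace ℝ C(K, ℝ) 0) μ = 0 := map_zero μ
  rw [h0]
  rfl

theorem IsEntangled.tendsto_weak (he : IsEntangled e) :
    Tendsto e atTop (@nhds _ (weakTopology C(K, ℝ)) 0) :=
  tendsto_weakTopology_iff.mpr fun μ => tendsto_functional_of_sum_abs_le he.sum_abs_le μ

theorem tendsto_moduleFilterBasis_topology_iff {E ι κ : Type*} [AddCommGroup E] [Module ℝ E]
    [Nonempty ι] (p : SeminormFamily ℝ E ι) {l : Filter κ} {f : κ → E} :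
    Tendsto f l (@nhds _ p.moduleFilterBasis.topology 0) ↔
      ∀ i, Tendsto (fun k => p i (f k)) l (𝓝 0) := by
  let _ : TopologicalSpace E := p.moduleFilterBasis.topology
  have hw : WithSeminorms p := ⟨rfl⟩
  refine (hw.tendsto_nhds f 0).trans (forall_congr' fun i => ?_)
  rw [Metric.tendsto_nhds]
  simp only [Real.dist_eq, sub_zero, abs_of_nonneg (apply_nonneg (p i) _)]

theorem tendsto_absWeakTopology_iff {ι : Type*} {l : Filter ι} {f : ι → C(K, ℝ)} :
    Tendsto f l (@nhds _ (absWeakTopology C(K, ℝ)) 0) ↔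
      ∀ ν : PositiveDual C(K, ℝ), Tendsto (fun i => ν.1 |f i|) l (𝓝 0) :=
  letI : Nonempty (PositiveDual C(K, ℝ)) := ⟨⟨0, fun _ _ => le_rfl⟩⟩
  tendsto_moduleFilterBasis_topology_iff (absWeakSeminorms C(K, ℝ))

theorem IsEntangled.tendsto_absWeak (he : IsEntangled e) :
    Tendsto e atTop (@nhds _ (absWeakTopology C(K, ℝ)) 0) := by
  refine tendsto_absWeakTopology_iff.mpr fun ν => ?_
  refine tendsto_functional_of_sum_abs_le (C := 3 / 2) (fun S y => ?_) ν.1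
  simpa using he.sum_abs_le S y

/-! ### Linear combinations of an entangled sequence and stable phase retrieval. -/

omit [CompactSpace K] in
/-- Values of a linear combination of an entangled sequence. -/
theorem linearCombination_apply_apply (a : ℕ →₀ ℝ) (y : K) :
    Finsupp.linearCombination ℝ e a y = ∑ m ∈ a.support, a m * e m y := by
  rw [Finsupp.linearCombination_apply, Finsupp.sum, ContinuousMap.sum_apply]
  rfl

theorem exists_forall_abs_le (a : ℕ →₀ ℝ) : ∃ n, ∀ m, |a m| ≤ |a n| := by
  by_cases h : a.support.Nonempty
  · obtain ⟨n, _, hn⟩ := a.support.exists_max_image (fun m => |a m|) h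
    refine ⟨n, fun m => ?_⟩
    by_cases hm : m ∈ a.support
    · exact hn m hm
    · rw [Finsupp.notMem_support_iff.mp hm, abs_zero]
      exact abs_nonneg _
  · rw [Finset.not_nonempty_iff_eq_empty, Finsupp.support_eq_empty] at h
    exact ⟨0, fun m => by simp [h]⟩

theorem IsEntangled.norm_linearCombination_le (he : IsEntangled e) {a : ℕ →₀ ℝ} {n : ℕ}
    (hn : ∀ m, |a m| ≤ |a n|) : ‖Finsupp.linearCombination ℝ e a‖ ≤ 3 / 2 * |a n| := by
  refine (ContinuousMap.norm_le _ (by positivity)).mpr fun y => ?_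
  rw [linearCombination_apply_apply]
  calc ‖∑ m ∈ a.support, a m * e m y‖ ≤ ∑ m ∈ a.support, |a n| * |e m y| := by
        refine (norm_sum_le _ _).trans (Finset.sum_le_sum fun m _ => ?_)
        rw [norm_mul]
        exact mul_le_mul_of_nonneg_right (hn m) (abs_nonneg _)
    _ = |a n| * ∑ m ∈ a.support, |e m y| := by rw [Finset.mul_sum]
    _ ≤ 3 / 2 * |a n| := by
        rw [mul_comm]
        exact mul_le_mul_of_nonneg_right (he.sum_abs_le _ y) (abs_nonneg _)

omit [CompactSpace K] in
theorem IsEntangled.exists_apply_eq (he : IsEntangled e) (n : ℕ) :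
    ∃ y, ∀ a, Finsupp.linearCombination ℝ e a y = a n := by
  obtain ⟨y, hy⟩ := he.peak n
  refine ⟨y, fun a => ?_⟩
  simp [linearCombination_apply_apply, hy]
  exact fun h => h.symm

theorem sum_two_points {x : ℕ → ℝ} {n k : ℕ} {c : ℝ} (hnk : n ≠ k)
    (hx : ∀ m, x m = if m = n then 1 else if m = k then c else 0) (a : ℕ →₀ ℝ) :
    ∑ m ∈ a.support, a m * x m = a n + a k * c := by
  have h : ∀ m, a m * x m = (if m = n then a m else 0) + if m = k then a m * c else 0 := by
    intro m
    rw [hx]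
    split_ifs with h1 h2
    · exact absurd (h1.symm.trans h2) hnk
    all_goals simp
  rw [Finset.sum_congr rfl fun m _ => h m, Finset.sum_add_distrib, Finset.sum_ite_eq',
    Finset.sum_ite_eq']
  congr 1
  · split_ifs with h'
    · rfl
    · exact (Finsupp.notMem_support_iff.mp h').symm
  · split_ifs with h'
    · rfl
    · rw [Finsupp.notMem_support_iff.mp h', zero_mul]

omit [CompactSpace K] in
/-- Two linear combinations of an entangled sequence are simultaneously large at some point. -/
theorem IsEntangled.exists_both_large (he : IsEntangled e) {a b : ℕ →₀ ℝ} {n k : ℕ}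
    (hn : ∀ m, |a m| ≤ |a n|) (hk : ∀ m, |b m| ≤ |b k|) :
    ∃ y, |a n| / 2 ≤ |Finsupp.linearCombination ℝ e a y| ∧
      |b k| / 2 ≤ |Finsupp.linearCombination ℝ e b y| := by
  have key : ∀ (a b : ℕ →₀ ℝ) (n k : ℕ), (∀ m, |a m| ≤ |a n|) → (∀ m, |b m| ≤ |b k|) → n < k →
      ∃ y, |a n| / 2 ≤ |Finsupp.linearCombination ℝ e a y| ∧
        |b k| / 2 ≤ |Finsupp.linearCombination ℝ e b y| := by
    intro a b n k hn hk hnk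
    obtain ⟨y, hy⟩ := he.pos n k hnk
    obtain ⟨z, hz⟩ := he.neg n k hnk
    -- The `n`-th coefficient of `a` dominates at the point of either sign.
    have h1 : ∀ c : ℝ, |c| = 1 / 2 → |a n| / 2 ≤ |a n + a k * c| := by
      intro c hc
      have h2 : |a k * c| ≤ |a n| / 2 := by
        rw [abs_mul, hc]
        linarith [hn k]
      have h3 := abs_sub_abs_le_abs_sub (a n) (-(a k * c))
      rw [abs_neg, sub_neg_eq_add] at h3
      linarith
    -- The values of the second combination at `y` and `z` differ by `b k`, so one of them has
    -- absolute value at least `|b k| / 2`.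
    by_cases hb : |b k| / 2 ≤ |b n + b k * (1 / 2)|
    · refine ⟨y, ?_, ?_⟩
      · rw [linearCombination_apply_apply, sum_two_points hnk.ne hy]
        exact h1 _ (by norm_num)
      · rwa [linearCombination_apply_apply, sum_two_points hnk.ne hy]
    · refine ⟨z, ?_, ?_⟩
      · rw [linearCombination_apply_apply, sum_two_points hnk.ne hz]
        exact h1 _ (by norm_num [abs_of_pos])
      · rw [linearCombination_apply_apply, sum_two_points hnk.ne hz]
        push Not at hb
        have h3 := abs_sub (b n + b k * (1 / 2)) (b n + b k * -(1 / 2))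
        have h4 : b n + b k * (1 / 2) - (b n + b k * -(1 / 2)) = b k := by ring
        rw [h4] at h3
        linarith
  rcases lt_trichotomy n k with h | rfl | h
  · exact key a b n k hn hk h
  · obtain ⟨y, hy⟩ := he.exists_apply_eq n
    refine ⟨y, ?_, ?_⟩ <;> (rw [hy]; linarith [abs_nonneg (a n), abs_nonneg (b n)])
  · obtain ⟨y, h1, h2⟩ := key b a k n hk hn h
    exact ⟨y, h2, h1⟩

/-- Translates SPR into a pointwise question: how large can `|g + h|` and `|g - h|` be at the same
point? -/
theorem min_abs_add_abs_sub (x y : ℝ) : min |x + y| |x - y| = |(|x| - |y|)| := by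
  grind

omit [CompactSpace K] in
theorem continuous_abs_continuousMap : Continuous fun f : C(K, ℝ) => |f| :=
  ContinuousMap.continuous_postcomp (⟨fun x : ℝ => |x|, continuous_abs⟩ : C(ℝ, ℝ))

/-- For `g`, `h` in the span, `g + h` and `g - h` both reach half of their largest coefficient at a
common point, while their norms are at most `3 / 2` of it; the ratio is the constant `3`. -/
theorem IsEntangled.hasSPR_closure (he : IsEntangled e) :
    HasSPR (Submodule.span ℝ (Set.range e)).topologicalClosure := by
  refine ⟨3, by norm_num, ?_⟩
  have hspan : ∀ g ∈ (Submodule.span ℝ (Set.range e) : Set C(K, ℝ)),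
      ∀ h ∈ (Submodule.span ℝ (Set.range e) : Set C(K, ℝ)),
      min ‖g + h‖ ‖g - h‖ ≤ 3 * ‖|g| - |h|‖ := by
    intro g hg h hh
    obtain ⟨a, ha⟩ := Finsupp.mem_span_range_iff_exists_finsupp.mp (add_mem hg hh)
    obtain ⟨b, hb⟩ := Finsupp.mem_span_range_iff_exists_finsupp.mp (sub_mem hg hh)
    rw [← Finsupp.linearCombination_apply] at ha hb
    obtain ⟨n, hn⟩ := exists_forall_abs_le a
    obtain ⟨k, hk⟩ := exists_forall_abs_le b
    obtain ⟨y, h1, h2⟩ := he.exists_both_large hn hk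
    have h3 := he.norm_linearCombination_le hn
    have h4 := he.norm_linearCombination_le hk
    rw [ha] at h1 h3
    rw [hb] at h2 h4
    have h5 := (|g| - |h|).norm_coe_le_norm y
    rw [ContinuousMap.sub_apply, ContinuousMap.abs_apply, ContinuousMap.abs_apply,
      Real.norm_eq_abs, ← min_abs_add_abs_sub] at h5
    rw [ContinuousMap.add_apply] at h1
    rw [ContinuousMap.sub_apply] at h2
    rcases min_le_iff.mp h5 with h6 | h6
    · exact min_le_iff.mpr (Or.inl (by linarith))
    · exact min_le_iff.mpr (Or.inr (by linarith))
  intro g hg h hh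
  -- Both sides are continuous, so the inequality passes to the closure one variable at a time.
  have hc1 : ∀ g : C(K, ℝ),
      IsClosed {h : C(K, ℝ) | min ‖g + h‖ ‖g - h‖ ≤ 3 * ‖|g| - |h|‖} := fun g =>
    isClosed_le (by fun_prop) (by
      have := continuous_abs_continuousMap (K := K)
      fun_prop)
  have hc2 : ∀ h : C(K, ℝ),
      IsClosed {g : C(K, ℝ) | min ‖g + h‖ ‖g - h‖ ≤ 3 * ‖|g| - |h|‖} := fun h =>
    isClosed_le (by fun_prop) (by
      have := continuous_abs_continuousMap (K := K)
      fun_prop)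
  have h1 : ∀ g ∈ (Submodule.span ℝ (Set.range e) : Set C(K, ℝ)),
      min ‖g + h‖ ‖g - h‖ ≤ 3 * ‖|g| - |h|‖ := fun g hg =>
    closure_minimal (fun h hh => hspan g hg h hh) (hc1 g) hh
  exact closure_minimal h1 (hc2 h) hg

theorem IsEntangled.not_finiteDimensional (he : IsEntangled e) :
    ¬ FiniteDimensional ℝ (Submodule.span ℝ (Set.range e)).topologicalClosure := by
  intro hfd
  have hli : LinearIndependent ℝ e := by
    rw [linearIndependent_iff]
    intro a ha
    ext n
    obtain ⟨y, hy⟩ := he.exists_apply_eq n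
    rw [← hy a, ha]
    simp
  have hli' : LinearIndependent ℝ (fun n => (⟨e n, Submodule.le_topologicalClosure _
      (Submodule.subset_span ⟨n, rfl⟩)⟩ :
        (Submodule.span ℝ (Set.range e)).topologicalClosure)) :=
    LinearIndependent.of_comp (Submodule.subtype _) hli
  have := hli'.finite
  exact not_finite ℕ

end Entangled

end DispersedCK

namespace DispersedCK

/-! ### Finitely many non-isolated points: the gliding hump. -/

section Finite

variable {K : Type*} [TopologicalSpace K] [CompactSpace K]

/-- If a continuous function is small at the non-isolated points, then it is small off a finite
set of isolated points. -/
theorem exists_finset_large {g : C(K, ℝ)} {ε : ℝ}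
    (hg : ∀ x, ¬ IsOpen ({x} : Set K) → |g x| < ε) :
    ∃ B : Finset K, (∀ x ∈ B, IsOpen ({x} : Set K)) ∧ ∀ x, x ∈ B ↔ ε ≤ |g x| := by
  have hiso : ∀ x ∈ {x : K | ε ≤ |g x|}, IsOpen ({x} : Set K) := fun x hx =>
    by_contra fun h => (hg x h).not_ge hx
  have hc : IsCompact {x : K | ε ≤ |g x|} :=
    (isClosed_le continuous_const (by fun_prop)).isCompact
  obtain ⟨B, hB, hcov⟩ := hc.elim_nhds_subcover (fun x => {x}) fun x hx =>
    (hiso x hx).mem_nhds rfl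
  refine ⟨B, fun x hx => hiso x (hB x hx), fun x => ⟨hB x, fun hx => ?_⟩⟩
  have := hcov hx
  simpa using this

omit [CompactSpace K] in
/-- The restriction of a continuous function to a finite set of isolated points. -/
theorem exists_restrict_finset [T1Space K] (g : C(K, ℝ)) {B : Finset K}
    (hB : ∀ x ∈ B, IsOpen ({x} : Set K)) :
    ∃ h : C(K, ℝ), (∀ x ∈ B, h x = g x) ∧ ∀ x ∉ B, h x = 0 := by
  have hclopen : IsClopen (B : Set K) := by
    refine ⟨B.finite_toSet.isClosed, ?_⟩
    rw [← Set.biUnion_of_singleton (B : Set K)]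
    exact isOpen_biUnion fun x hx => hB x hx
  refine ⟨⟨(B : Set K).indicator g, g.continuous.indicator (by simp [hclopen.frontier_eq])⟩, fun x hx => ?_, fun x hx => ?_⟩
  · exact Set.indicator_of_mem (Finset.mem_coe.mpr hx) _
  · exact Set.indicator_of_notMem (fun h => hx (Finset.mem_coe.mp h)) _

/-- If there are finitely many non-isolated points, almost disjoint sequences can be selected from
normalized families which are arbitrarily small on finite sets. -/
theorem exists_almostDisjoint [T1Space K] (hK : {x : K | ¬ IsOpen ({x} : Set K)}.Finite)
    {P : Type*} {f : P → C(K, ℝ)} (hf : ∀ i, ‖f i‖ = 1) {Q : ℕ → P → Prop}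
    (hQ : ∀ n (A : Finset K) (ε : ℝ), 0 < ε → ∃ i, Q n i ∧ ∀ x ∈ A, |f i x| < ε) :
    ∃ p : ℕ → P, (∀ n, Q n (p n)) ∧ AlmostDisjoint fun n => f (p n) := by
  classical
  -- `A` collects the points where earlier choices were large. Smallness on `A` keeps the new large
  -- set `B` disjoint from it; smallness at the non-isolated points makes `B` a finite set of
  -- isolated points.
  have hstep : ∀ n (A : Finset K), ∃ i, ∃ B : Finset K, Q n i ∧ (∀ x ∈ A, |f i x| < (1 / 2) ^ n) ∧
      (∀ x ∈ B, IsOpen ({x} : Set K)) ∧ ∀ x, x ∈ B ↔ (1 / 2) ^ n ≤ |f i x| := by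
    intro n A
    obtain ⟨i, hi, hA⟩ := hQ n (A ∪ hK.toFinset) ((1 / 2) ^ n) (by positivity)
    obtain ⟨B, hB, hB'⟩ := exists_finset_large (g := f i) (ε := (1 / 2) ^ n) fun x hx =>
      hA x (Finset.mem_union_right _ (hK.mem_toFinset.mpr hx))
    exact ⟨i, B, hi, fun x hx => hA x (Finset.mem_union_left _ hx), hB, hB'⟩
  choose p B hpQ hpA hBo hB using hstep
  let A : ℕ → Finset K := Nat.rec ∅ fun n A => A ∪ B n A
  have hA : ∀ n, A (n + 1) = A n ∪ B n (A n) := fun n => rfl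
  have hmono : Monotone A := monotone_nat_of_le_succ fun n => by
    rw [hA]
    exact Finset.subset_union_left
  choose g hg hg0 using fun n => exists_restrict_finset (f (p n (A n))) (hBo n (A n))
  refine ⟨fun n => p n (A n), fun n => hpQ n _, fun n => hf _, g, ?_, ?_⟩
  · have key : ∀ m n, m < n → ∀ y, g m y = 0 ∨ g n y = 0 := by
      intro m n hmn y
      by_cases hy : y ∈ B m (A m)
      · right
        refine hg0 n y fun hyn => ?_
        have h1 : y ∈ A n := hmono hmn (by rw [hA]; exact Finset.mem_union_right _ hy)
        exact ((hB n _ y).mp hyn).not_gt (hpA n _ y h1)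
      · exact Or.inl (hg0 m y hy)
    intro m n hmn
    rw [latDisjoint_iff]
    rcases lt_or_gt_of_ne hmn with h | h
    · exact key m n h
    · exact fun y => (key n m h y).symm
  · refine squeeze_zero (fun n => norm_nonneg _) (fun n => ?_)
      (tendsto_pow_atTop_nhds_zero_of_lt_one (r := (1 / 2 : ℝ)) (by norm_num) (by norm_num))
    refine (ContinuousMap.norm_le _ (by positivity)).mpr fun y => ?_
    rw [ContinuousMap.sub_apply]
    by_cases hy : y ∈ B n (A n)
    · rw [hg n y hy, sub_self, norm_zero]
      positivity
    · rw [hg0 n y hy, zero_sub, norm_neg]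
      exact (not_le.mp fun h => hy ((hB n _ y).mpr h)).le

omit [CompactSpace K] in
theorem tendsto_pointwiseTopology_iff {ι : Type*} {l : Filter ι} {f : ι → C(K, ℝ)} :
    Tendsto f l (@nhds _ (pointwiseTopology K) 0) ↔ ∀ x, Tendsto (fun i => f i x) l (𝓝 0) := by
  rw [nhds_induced, tendsto_comap_iff, tendsto_pi_nhds]
  rfl

theorem kadecPelczynskiFor_pointwiseTopology [T1Space K]
    (hK : {x : K | ¬ IsOpen ({x} : Set K)}.Finite) (P : Type*) [Preorder P] [IsDirectedOrder P]
    [Nonempty P] : KadecPelczynskiFor (pointwiseTopology K) P := by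
  intro f hf hlim q
  rw [tendsto_pointwiseTopology_iff] at hlim
  refine exists_almostDisjoint hK hf (Q := fun n i => q n ≤ i) fun n A ε hε => ?_
  have h1 : ∀ᶠ i in atTop, ∀ x ∈ A, |f i x| < ε := by
    rw [Filter.eventually_all_finset]
    intro x _
    have := (hlim x).abs
    rw [abs_zero] at this
    exact this.eventually (gt_mem_nhds hε)
  exact ((eventually_ge_atTop (q n)).and h1).exists

theorem finiteDimensional_of_isDispersed [T1Space K]
    (hK : {x : K | ¬ IsOpen ({x} : Set K)}.Finite) {E : Submodule ℝ C(K, ℝ)}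
    (hE : IsDispersed E) : FiniteDimensional ℝ E := by
  by_contra hfd
  have hex : ∀ A : Finset K, ∃ f ∈ E, ‖f‖ = 1 ∧ ∀ x ∈ A, f x = 0 := by
    intro A
    let T : E →ₗ[ℝ] (A → ℝ) :=
      { toFun := fun f x => (f : C(K, ℝ)) x
        map_add' := fun _ _ => rfl
        map_smul' := fun _ _ => rfl }
    -- Evaluation on `A` has finite-dimensional target, so it has a kernel on an
    -- infinite-dimensional `E`.
    have hT : ¬ Function.Injective T := fun h => hfd (Module.Finite.of_injective T h)
    rw [← LinearMap.ker_eq_bot, Submodule.eq_bot_iff] at hT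
    push Not at hT
    obtain ⟨f, hf, hf0⟩ := hT
    have hne : ‖(f : C(K, ℝ))‖ ≠ 0 := norm_ne_zero_iff.mpr fun h => hf0 (Subtype.ext h)
    refine ⟨‖(f : C(K, ℝ))‖⁻¹ • (f : C(K, ℝ)), E.smul_mem _ f.2, ?_, fun x hx => ?_⟩
    · rw [norm_smul, norm_inv, norm_norm, inv_mul_cancel₀ hne]
    · have : (f : C(K, ℝ)) x = 0 := congrFun (LinearMap.mem_ker.mp hf) ⟨x, hx⟩
      rw [ContinuousMap.smul_apply, this, smul_zero]
  choose f hfE hf hf0 using hex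
  obtain ⟨p, _, hp⟩ := exists_almostDisjoint hK hf (Q := fun _ _ => True) fun _ A ε hε =>
    ⟨A, trivial, fun x hx => by rwa [hf0 A x hx, abs_zero]⟩
  exact hE ⟨_, fun n => hfE (p n), hp⟩

/-! ### From SPR to 2-dispersed to dispersed. -/

theorem LatDisjoint.smul {f g : C(K, ℝ)} (h : LatDisjoint f g) (a b : ℝ) :
    LatDisjoint (a • f) (b • g) := by
  rw [latDisjoint_iff] at h ⊢
  intro y
  rcases h y with h | h <;> simp [h]

theorem IsNDispersed.isDispersed {E : Submodule ℝ C(K, ℝ)} (hE : IsNDispersed 2 E) :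
    IsDispersed E := by
  obtain ⟨r, hr, hE⟩ := hE
  rintro ⟨e, heE, he, f, hf, hlim⟩
  -- The bound `1` keeps `f n` nonzero for normalization; `r / 2` is spent twice, on normalizing `f
  -- n` and on replacing it by `e n`.
  obtain ⟨N, hN⟩ := eventually_atTop.mp
    (hlim.eventually (gt_mem_nhds (show (0 : ℝ) < min 1 (r / 2) by positivity)))
  have hnorm : ∀ n, N ≤ n → |1 - ‖f n‖| ≤ ‖f n - e n‖ := by
    intro n _
    rw [← he n, abs_sub_comm]
    exact abs_norm_sub_norm_le _ _
  have hpos : ∀ n, N ≤ n → 0 < ‖f n‖ := by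
    intro n hn
    have h1 := (hN n hn).trans_le (min_le_left _ _)
    have h2 := le_abs_self (1 - ‖f n‖)
    linarith [hnorm n hn]
  refine hE ⟨fun k => ‖f (N + k)‖⁻¹ • f (N + k), fun k => ?_, fun j k hjk => ?_, fun k => ?_⟩
  · rw [norm_smul, norm_inv, norm_norm, inv_mul_cancel₀ (hpos _ (by omega)).ne']
  · exact (hf _ _ (by omega)).smul _ _
  · refine (Metric.infDist_le_dist_of_mem (heE (N + k))).trans_lt ?_
    have hk : N ≤ N + (k : ℕ) := by omega
    rw [dist_eq_norm]
    have h1 : ‖‖f (N + k)‖⁻¹ • f (N + k) - f (N + k)‖ = |1 - ‖f (N + k)‖| := by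
      have : ‖f (N + k)‖⁻¹ • f (N + k) - f (N + k) = (‖f (N + k)‖⁻¹ - 1) • f (N + k) := by
        rw [sub_smul, one_smul]
      rw [this, norm_smul, Real.norm_eq_abs, ← abs_of_pos (hpos _ hk), ← abs_mul,
        abs_of_pos (hpos _ hk), sub_mul, inv_mul_cancel₀ (hpos _ hk).ne', one_mul]
    have h2 := norm_sub_le_norm_sub_add_norm_sub (‖f (N + k)‖⁻¹ • f (N + k)) (f (N + k))
      (e (N + k))
    have h3 := (hN _ hk).trans_le (min_le_right _ _)
    linarith [hnorm _ hk]

/-- If `u`, `w` in `E` are near a disjoint normalized pair, then `|u| ∧ |w|` is small, and it equals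
`||g| - |h||` for the half sum `g` and half difference `h`. SPR then makes `u` or `w` small,
although both have norm near `1`. With `r = 1 / (2 * (1 + R))` this would give `1 - r < R * r`,
whereas `r * (1 + R) = 1 / 2`. -/
theorem HasSPR.isNDispersed {E : Submodule ℝ C(K, ℝ)} (hE : HasSPR E) : IsNDispersed 2 E := by
  obtain ⟨R, hR, hE⟩ := hE
  refine ⟨1 / (2 * (1 + R)), by positivity, ?_⟩
  rintro ⟨f, hf, hd, hdist⟩
  have hne : (E : Set C(K, ℝ)).Nonempty := ⟨0, E.zero_mem⟩
  obtain ⟨u, hu, hu'⟩ := (Metric.infDist_lt_iff hne).mp (hdist 0)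
  obtain ⟨w, hw, hw'⟩ := (Metric.infDist_lt_iff hne).mp (hdist 1)
  rw [dist_eq_norm] at hu' hw'
  set r : ℝ := 1 / (2 * (1 + R)) with hr
  have hrR : r * (1 + R) = 1 / 2 := by
    rw [hr]
    field_simp
  have hr0 : 0 < r := by positivity
  have hmain := hE ((1 / 2 : ℝ) • (u + w)) (E.smul_mem _ (E.add_mem hu hw))
    ((1 / 2 : ℝ) • (u - w)) (E.smul_mem _ (E.sub_mem hu hw))
  have h1 : (1 / 2 : ℝ) • (u + w) + (1 / 2 : ℝ) • (u - w) = u := by module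
  have h2 : (1 / 2 : ℝ) • (u + w) - (1 / 2 : ℝ) • (u - w) = w := by module
  rw [h1, h2] at hmain
  have h3 : ‖|(1 / 2 : ℝ) • (u + w)| - |(1 / 2 : ℝ) • (u - w)|‖ ≤ r := by
    refine (ContinuousMap.norm_le _ hr0.le).mpr fun y => ?_
    rw [ContinuousMap.sub_apply, ContinuousMap.abs_apply, ContinuousMap.abs_apply,
      Real.norm_eq_abs, ← min_abs_add_abs_sub, ← ContinuousMap.add_apply,
      ← ContinuousMap.sub_apply, h1, h2]
    rcases latDisjoint_iff.mp (hd 0 1 (by decide)) y with h | h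
    · have h4 := (f 0 - u).norm_coe_le_norm y
      rw [ContinuousMap.sub_apply, h, zero_sub, norm_neg, Real.norm_eq_abs] at h4
      exact (min_le_left _ _).trans (h4.trans hu'.le)
    · have h4 := (f 1 - w).norm_coe_le_norm y
      rw [ContinuousMap.sub_apply, h, zero_sub, norm_neg, Real.norm_eq_abs] at h4
      exact (min_le_right _ _).trans (h4.trans hw'.le)
  have h4 : R * ‖|(1 / 2 : ℝ) • (u + w)| - |(1 / 2 : ℝ) • (u - w)|‖ ≤ R * r :=
    mul_le_mul_of_nonneg_left h3 (by linarith)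
  have h5 := norm_sub_norm_le (f 0) u
  have h6 := norm_sub_norm_le (f 1) w
  rw [hf] at h5 h6
  rcases min_le_iff.mp hmain with h | h <;> nlinarith

/-! ### The order continuous part of `C(K)`. -/

variable (K) in
/-- The ideal of the functions that vanish at the non-isolated points. -/
def vanishingIdeal : Submodule ℝ C(K, ℝ) where
  carrier := {f | ∀ x, ¬ IsOpen ({x} : Set K) → f x = 0}
  add_mem' := fun hf hg x hx => by rw [ContinuousMap.add_apply, hf x hx, hg x hx, add_zero]
  zero_mem' := fun _ _ => rfl
  smul_mem' := fun c f hf x hx => by rw [ContinuousMap.smul_apply, hf x hx, smul_zero]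

theorem isLatticeIdeal_vanishingIdeal : IsLatticeIdeal (vanishingIdeal K) := by
  intro f hf g hgf x hx
  have h : |g x| ≤ |f x| := hgf x
  rw [hf x hx, abs_zero] at h
  exact abs_nonpos_iff.mp h

/-- A Dini-type argument: `d₀` is large only on a finite set of isolated points, and directedness
yields one element below `d₀` that is small at all of them. -/
theorem hasOrderContinuousNorm_vanishingIdeal [T1Space K] :
    HasOrderContinuousNorm (vanishingIdeal K) := by
  intro D ⟨d₀, hd₀⟩ hdir hglb ε hε
  obtain ⟨B, hBo, hB⟩ := exists_finset_large (g := (d₀ : C(K, ℝ))) (ε := ε / 2) fun x hx => by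
    rw [d₀.2 x hx, abs_zero]
    linarith
  -- Otherwise `ε / 2` times the indicator of the isolated point `x` would be a lower bound in the
  -- ideal that is not below `0`.
  have hsmall : ∀ x ∈ B, ∃ d ∈ D, (d : C(K, ℝ)) x < ε / 2 := by
    intro x hx
    by_contra! h
    have hxo := hBo x hx
    obtain ⟨g, hg, hg0⟩ := exists_restrict_finset (ContinuousMap.const K (ε / 2)) (B := {x})
      (fun y hy => by rwa [Finset.mem_singleton.mp hy])
    have hgJ : g ∈ vanishingIdeal K := fun y hy => hg0 y fun hyx =>
      hy (by rwa [Finset.mem_singleton.mp hyx])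
    have hlb : (⟨g, hgJ⟩ : vanishingIdeal K) ∈ lowerBounds D := by
      intro d hd y
      change g y ≤ (d : C(K, ℝ)) y
      by_cases hyx : y = x
      · rw [hyx, hg x (Finset.mem_singleton_self x)]
        exact h d hd
      · rw [hg0 y (by simpa using hyx)]
        exact hglb.1 hd y
    have h1 : g x ≤ 0 := hglb.2 hlb x
    rw [hg x (Finset.mem_singleton_self x), ContinuousMap.const_apply] at h1
    linarith
  have hall : ∀ A : Finset K, A ⊆ B → ∃ d ∈ D, d ≤ d₀ ∧ ∀ x ∈ A, (d : C(K, ℝ)) x < ε / 2 := by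
    classical
    intro A
    induction A using Finset.induction_on with
    | empty => exact fun _ => ⟨d₀, hd₀, le_rfl, by simp⟩
    | insert a A _ ih =>
      intro hA
      obtain ⟨d, hd, hdd, hdA⟩ := ih ((Finset.subset_insert a A).trans hA)
      obtain ⟨d', hd', hda⟩ := hsmall a (hA (Finset.mem_insert_self a A))
      obtain ⟨c, hc, hcd, hcd'⟩ := hdir d hd d' hd'
      refine ⟨c, hc, le_trans hcd hdd, fun x hx => ?_⟩
      rcases Finset.mem_insert.mp hx with rfl | hx
      · exact lt_of_le_of_lt (hcd' x) hda
      · exact lt_of_le_of_lt (hcd x) (hdA x hx)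
  obtain ⟨d, hd, hdd, hdB⟩ := hall B subset_rfl
  refine ⟨d, hd, lt_of_le_of_lt ?_ (half_lt_self hε)⟩
  refine (ContinuousMap.norm_le (d : C(K, ℝ)) (by positivity)).mpr fun y => ?_
  have hdy : 0 ≤ (d : C(K, ℝ)) y := hglb.1 hd y
  rw [Real.norm_eq_abs, abs_of_nonneg hdy]
  by_cases hy : y ∈ B
  · exact (hdB y hy).le
  · have h1 : |(d₀ : C(K, ℝ)) y| < ε / 2 := not_le.mp fun h => hy ((hB y).mpr h)
    exact (show (d : C(K, ℝ)) y ≤ (d₀ : C(K, ℝ)) y from hdd y).trans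
      ((le_abs_self _).trans h1.le)

/-- If `f x₀ ≠ 0` at a non-isolated `x₀`, the functions between `0` and `|f|` that agree with `|f|`
at `x₀` have norm at least `|f x₀|`. Yet their infimum is `0`: bumps at `x₀` push a lower bound to
at most `0` off `x₀`, and density extends this to `x₀`. -/
theorem le_vanishingIdeal [T2Space K] {I : Submodule ℝ C(K, ℝ)} (hI : IsLatticeIdeal I)
    (hoc : HasOrderContinuousNorm I) : I ≤ vanishingIdeal K := by
  intro f hf x₀ hx₀
  by_contra hne
  have hNe : NeBot (𝓝[≠] x₀) := ⟨fun h => hx₀ ((isOpen_singleton_iff_punctured_nhds x₀).mpr h)⟩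
  have habs : ∀ g : C(K, ℝ), (∀ y, |g y| ≤ |f y|) → g ∈ I := fun g hg => hI hf hg
  let D : Set I := {g | (∀ y, 0 ≤ (g : C(K, ℝ)) y ∧ (g : C(K, ℝ)) y ≤ |f y|) ∧
    (g : C(K, ℝ)) x₀ = |f x₀|}
  have hDne : D.Nonempty := by
    refine ⟨⟨|f|, habs _ fun y => ?_⟩, fun y => ⟨?_, ?_⟩, ?_⟩
    · rw [ContinuousMap.abs_apply, abs_abs]
    · exact abs_nonneg (f y)
    · exact le_rfl
    · rfl
  have hDdir : DirectedOn (· ≥ ·) D := by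
    intro g hg h hh
    have hb : ∀ y, 0 ≤ ((g : C(K, ℝ)) ⊓ (h : C(K, ℝ))) y ∧
        ((g : C(K, ℝ)) ⊓ (h : C(K, ℝ))) y ≤ |f y| := fun y => by
      rw [ContinuousMap.inf_apply]
      exact ⟨le_inf (hg.1 y).1 (hh.1 y).1, inf_le_left.trans (hg.1 y).2⟩
    refine ⟨⟨(g : C(K, ℝ)) ⊓ (h : C(K, ℝ)), habs _ fun y => ?_⟩, ⟨hb, ?_⟩, ?_, ?_⟩
    · rw [abs_of_nonneg (hb y).1]
      exact (hb y).2
    · rw [ContinuousMap.inf_apply, hg.2, hh.2, inf_idem]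
    · exact (inf_le_left : (g : C(K, ℝ)) ⊓ (h : C(K, ℝ)) ≤ g)
    · exact (inf_le_right : (g : C(K, ℝ)) ⊓ (h : C(K, ℝ)) ≤ h)
  have hglb : IsGLB D 0 := by
    refine ⟨fun g hg y => (hg.1 y).1, fun h hh => ?_⟩
    have hoff : ∀ x, x ≠ x₀ → (h : C(K, ℝ)) x ≤ 0 := by
      intro x hx
      obtain ⟨b, V, _, hxV, hb1, hb0, hb⟩ := exists_bump (isOpen_compl_singleton (x := x))
        (show x₀ ∈ ({x}ᶜ : Set K) from fun h => hx h.symm)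
      have hnn : ∀ y, 0 ≤ (|f| * b) y ∧ (|f| * b) y ≤ |f y| := fun y => by
        rw [ContinuousMap.mul_apply, ContinuousMap.abs_apply]
        exact ⟨mul_nonneg (abs_nonneg _) (hb y).1, mul_le_of_le_one_right (abs_nonneg _) (hb y).2⟩
      have hmem : |f| * b ∈ I := habs _ fun y => by
        rw [abs_of_nonneg (hnn y).1]
        exact (hnn y).2
      have hD : (⟨|f| * b, hmem⟩ : I) ∈ D := by
        refine ⟨hnn, ?_⟩
        change (|f| * b) x₀ = |f x₀|
        rw [ContinuousMap.mul_apply, hb1 x₀ hxV, mul_one, ContinuousMap.abs_apply]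
      have h1 : (h : C(K, ℝ)) x ≤ (|f| * b) x := hh hD x
      rwa [ContinuousMap.mul_apply, hb0 x (by simp), mul_zero] at h1
    have hclosed : IsClosed {x : K | (h : C(K, ℝ)) x ≤ 0} :=
      isClosed_le (by fun_prop) continuous_const
    intro x
    exact closure_minimal (fun x hx => hoff x hx) hclosed (dense_compl_singleton x₀ x)
  obtain ⟨d, hd, hlt⟩ := hoc D hDne hDdir hglb |f x₀| (abs_pos.mpr hne)
  have h1 := (d : C(K, ℝ)).norm_coe_le_norm x₀
  rw [hd.2, Real.norm_eq_abs, abs_abs] at h1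
  exact h1.not_gt hlt

theorem orderContinuousPart_eq [T2Space K] :
    orderContinuousPart C(K, ℝ) = vanishingIdeal K :=
  le_antisymm (sSup_le fun _ hI => le_vanishingIdeal hI.1 hI.2)
    (le_sSup ⟨isLatticeIdeal_vanishingIdeal, hasOrderContinuousNorm_vanishingIdeal⟩)

omit [CompactSpace K] in
theorem finiteDimensional_quotient_vanishingIdeal
    (hK : {x : K | ¬ IsOpen ({x} : Set K)}.Finite) :
    FiniteDimensional ℝ (C(K, ℝ) ⧸ vanishingIdeal K) := by
  have : Finite {x : K | ¬ IsOpen ({x} : Set K)} := hK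
  let T : C(K, ℝ) →ₗ[ℝ] ({x : K | ¬ IsOpen ({x} : Set K)} → ℝ) :=
    { toFun := fun f x => f x
      map_add' := fun _ _ => rfl
      map_smul' := fun _ _ => rfl }
  have hker : LinearMap.ker T = vanishingIdeal K := by
    ext f
    exact ⟨fun h x hx => congrFun (LinearMap.mem_ker.mp h) ⟨x, hx⟩,
      fun h => LinearMap.mem_ker.mpr (funext fun x => h x x.2)⟩
  rw [← hker]
  exact Module.Finite.equiv T.quotKerEquivRange.symm

/-- Evaluations at non-isolated points factor through the quotient and separate the classes of
disjoint bumps at infinitely many such points. -/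
theorem finite_of_finiteDimensional_quotient_vanishingIdeal [T2Space K]
    (hfd : FiniteDimensional ℝ (C(K, ℝ) ⧸ vanishingIdeal K)) :
    {x : K | ¬ IsOpen ({x} : Set K)}.Finite := by
  by_contra hinf
  obtain ⟨x, U, hxS, hxU, hUo, hUd⟩ := exists_seq_mem_isOpen_pairwise_disjoint hinf
  choose ψ V hVo hxV hψ1 hψ0 hψ using fun n => exists_bump (hUo n) (hxU n)
  have hval : ∀ m n, ψ m (x n) = if m = n then 1 else 0 := by
    intro m n
    split_ifs with h
    · rw [h]
      exact hψ1 n _ (hxV n)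
    · exact hψ0 m _ (Set.disjoint_right.mp (hUd m n h) (hxU n))
  have hli : LinearIndependent ℝ fun n => (vanishingIdeal K).mkQ (ψ n) := by
    rw [linearIndependent_iff]
    intro a ha
    have h1 : Finsupp.linearCombination ℝ ψ a ∈ vanishingIdeal K := by
      rw [← Submodule.ker_mkQ (vanishingIdeal K), LinearMap.mem_ker, ← ha]
      exact Finsupp.apply_linearCombination ℝ _ _ _
    ext n
    have h2 := h1 (x n) (hxS n)
    rw [linearCombination_apply_apply] at h2
    simp only [hval] at h2
    simpa using h2
  have := hli.finite
  exact not_finite ℕ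

/-! ### Comparison of topologies and of index universes. -/

theorem tendsto_pointwiseTopology_of_weakTopology {ι : Type*} {l : Filter ι} {f : ι → C(K, ℝ)}
    (hf : Tendsto f l (@nhds _ (weakTopology C(K, ℝ)) 0)) :
    Tendsto f l (@nhds _ (pointwiseTopology K) 0) := by
  rw [tendsto_pointwiseTopology_iff]
  exact fun x => tendsto_weakTopology_iff.mp hf (ContinuousMap.evalCLM ℝ x)

theorem tendsto_pointwiseTopology_of_absWeakTopology {ι : Type*} {l : Filter ι}
    {f : ι → C(K, ℝ)} (hf : Tendsto f l (@nhds _ (absWeakTopology C(K, ℝ)) 0)) :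
    Tendsto f l (@nhds _ (pointwiseTopology K) 0) := by
  rw [tendsto_pointwiseTopology_iff]
  intro x
  have h := tendsto_absWeakTopology_iff.mp hf ⟨ContinuousMap.evalCLM ℝ x, fun f hf => hf x⟩
  exact (tendsto_zero_iff_abs_tendsto_zero _).mpr h

end Finite

section Universe

variable {F : Type*} [NormedAddCommGroup F] [Lattice F]

theorem HasKadecPelczynski.hasSeqKadecPelczynski {τ : TopologicalSpace F}
    (h : HasKadecPelczynski.{_, v} τ) : HasSeqKadecPelczynski τ := by
  intro f hf hlim q
  -- Nets are indexed in universe `v`, so a sequence is viewed as a net over a lifted copy of `ℕ`.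
  have hdown : Tendsto (ULift.down : ULift.{v} ℕ → ℕ) atTop atTop :=
    tendsto_atTop_atTop.mpr fun b => ⟨ULift.up b, fun a ha => ha⟩
  obtain ⟨p, hp, hp'⟩ := h (ULift.{v} ℕ) (fun i => f i.down) (fun i => hf _)
    (hlim.comp hdown) fun n => ULift.up (q n)
  exact ⟨fun n => (p n).down, hp, hp'⟩

theorem HasSeqKadecPelczynski.of_tendsto {τ σ : TopologicalSpace F}
    (h : HasSeqKadecPelczynski τ)
    (hτσ : ∀ f : ℕ → F, Tendsto f atTop (@nhds F σ 0) → Tendsto f atTop (@nhds F τ 0)) :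
    HasSeqKadecPelczynski σ :=
  fun f hf hlim => h f hf (hτσ f hlim)

end Universe

end DispersedCK

theorem mainTheorem5 (K : Type u) [TopologicalSpace K] [CompactSpace K] [T2Space K] :
    List.TFAE [
      {x : K | ¬ IsOpen ({x} : Set K)}.Finite,
      FiniteDimensional ℝ (C(K, ℝ) ⧸ DispersedCK.orderContinuousPart C(K, ℝ)),
      DispersedCK.HasKadecPelczynski.{u, v} (DispersedCK.pointwiseTopology K),
      DispersedCK.HasSeqKadecPelczynski (DispersedCK.pointwiseTopology K),
      DispersedCK.HasSeqKadecPelczynski (DispersedCK.weakTopology C(K, ℝ)),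
      DispersedCK.HasSeqKadecPelczynski (DispersedCK.absWeakTopology C(K, ℝ)),
      ∀ E : Submodule ℝ C(K, ℝ), IsClosed (E : Set C(K, ℝ)) →
        DispersedCK.IsDispersed E → FiniteDimensional ℝ E,
      ∀ E : Submodule ℝ C(K, ℝ), IsClosed (E : Set C(K, ℝ)) →
        DispersedCK.IsNDispersed 2 E → FiniteDimensional ℝ E,
      ∀ E : Submodule ℝ C(K, ℝ), IsClosed (E : Set C(K, ℝ)) →
        DispersedCK.HasSPR E → FiniteDimensional ℝ E] := by
  tfae_have 1 → 2 := fun h => by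
    rw [DispersedCK.orderContinuousPart_eq]
    exact DispersedCK.finiteDimensional_quotient_vanishingIdeal h
  tfae_have 2 → 1 := fun h => by
    rw [DispersedCK.orderContinuousPart_eq] at h
    exact DispersedCK.finite_of_finiteDimensional_quotient_vanishingIdeal h
  tfae_have 1 → 3 := fun h P _ _ _ => DispersedCK.kadecPelczynskiFor_pointwiseTopology h P
  tfae_have 3 → 4 := fun h => h.hasSeqKadecPelczynski
  tfae_have 4 → 5 := fun h =>
    h.of_tendsto fun _ => DispersedCK.tendsto_pointwiseTopology_of_weakTopology
  tfae_have 4 → 6 := fun h =>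
    h.of_tendsto fun _ => DispersedCK.tendsto_pointwiseTopology_of_absWeakTopology
  tfae_have 5 → 1 := fun h => by
    by_contra hinf
    obtain ⟨e, he⟩ := DispersedCK.exists_isEntangled hinf
    exact he.not_hasSeqKadecPelczynski he.tendsto_weak h
  tfae_have 6 → 1 := fun h => by
    by_contra hinf
    obtain ⟨e, he⟩ := DispersedCK.exists_isEntangled hinf
    exact he.not_hasSeqKadecPelczynski he.tendsto_absWeak h
  tfae_have 1 → 7 := fun h _ _ hE => DispersedCK.finiteDimensional_of_isDispersed h hE
  tfae_have 7 → 8 := fun h E hc hE => h E hc hE.isDispersed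
  tfae_have 8 → 9 := fun h E hc hE => h E hc hE.isNDispersed
  tfae_have 9 → 1 := fun h => by
    by_contra hinf
    obtain ⟨e, he⟩ := DispersedCK.exists_isEntangled hinf
    exact he.not_finiteDimensional
      (h _ (Submodule.isClosed_topologicalClosure _) he.hasSPR_closure)
  tfae_finish
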